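/- Let $X$ be a completely regular (Hausdorff) topological space and let $\mathcal M_r(X)$ be the real vector space of signed Radon measures on $X$, that is, of the finite signed Borel measures $\mu$ such that for every Borel set $B$ and every $\varepsilon>0$ there is a compact set $K\subset B$ with $|\mu|(B\setminus K)<\varepsilon$. The weak topology on $\mathcal M_r(X)$ is generated by the seminorms $\mu\mapsto\left|\int_X f\,d\mu\right|$, where $f$ runs over the bounded continuous real functions on $X$. For a continuous pseudometric $p$ on $X$ put $$\|\mu\|_{KR,p}=\sup\Bigl\{\int_X f\,d\mu:\ |f|\le 1,\ |f(x)-f(y)|\le p(x,y)\ \text{for all } x,y\in X\Bigr\}.$$ For a family $\Pi$ of continuous pseudometrics let $\tau_{KR}(\Pi)$ be the topology on $\mathcal M_r(X)$ generated by the seminorms $\|\cdot\|_{KR,p}$, $p\in\Pi$, and let $\tau_{KR}$ be the topology obtained when $\Pi$ consists of all continuous pseudometrics on $X$. Suppose that $X$ is separable or that there is a countable collection of continuous real functions on $X$ separating the points of $X$. Then for every weakly compact set $S\subset\mathcal M_r(X)$ the weak topology and $\tau_{KR}$ induce the same topology on $S$. More generally, the weak topology and $\tau_{KR}(\Pi)$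 induce the same topology on $S$ for every nonempty family $\Pi$ of pseudometrics whose open balls generate the topology of $X$ and which is directed, i.e., for all $p,q\in\Pi$ there are $r\in\Pi$ and a constant $C$ with $\max(p,q)\le C\,r$ (for instance, $\Pi$ is closed under maxima). -/

import Mathlib

open MeasureTheory Topology
open scoped BoundedContinuousFunction ENNReal

namespace KantorovichRubinstein

noncomputable section

/-- The topology generated by a set of seminorms: the coarsest one that is finer than the topology
of each of the semimetrics `(x, y) ↦ q (x - y)`. -/
@[reducible]
def seminormTopology {E : Type*} [AddCommGroup E] [Module ℝ E] (Q : Set (Seminorm ℝ E)) :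
    TopologicalSpace E :=
  ⨅ q ∈ Q, q.toSeminormedAddCommGroup.toUniformSpace.toTopologicalSpace

section Pseudometrics

variable (X : Type*) [t : TopologicalSpace X]

/-- All continuous pseudometrics on `X`. -/
def continuousPseudometrics : Set (PseudoMetric X ℝ) :=
  {p | Continuous fun z : X × X => p z.1 z.2}

variable {X}

/-- The topology of `X` is generated by the (open) balls of the pseudometrics in `P`. -/
def GeneratesTopology (P : Set (PseudoMetric X ℝ)) : Prop :=
  t = TopologicalSpace.generateFrom
    {U | ∃ p ∈ P, ∃ x : X, ∃ r : ℝ, 0 < r ∧ U = {y | p x y < r}}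

/-- `P` is nonempty and any two members are dominated by a constant multiple of a third one
(for instance, `P` is closed under maxima). -/
def IsDirectedFamily (P : Set (PseudoMetric X ℝ)) : Prop :=
  P.Nonempty ∧ ∀ p ∈ P, ∀ q ∈ P, ∃ r ∈ P, ∃ C : ℝ, ∀ x y, p x y ≤ C * r x y ∧ q x y ≤ C * r x y

/-- The functions `f` with `|f| ≤ 1` that are `1`-Lipschitz for `p`. (If `p` is continuous, then
the continuity of `f` follows from the Lipschitz condition.) -/
def lipUnitBall (p : PseudoMetric X ℝ) : Set (X →ᵇ ℝ) :=
  {f | (∀ x, |f x| ≤ 1) ∧ ∀ x y, |f x - f y| ≤ p x y}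

theorem neg_mem_lipUnitBall {p : PseudoMetric X ℝ} {f : X →ᵇ ℝ} (hf : f ∈ lipUnitBall p) :
    -f ∈ lipUnitBall p := by
  refine ⟨fun x => by simpa using hf.1 x, fun x y => ?_⟩
  have := hf.2 y x
  rw [p.symm x y]
  simpa [neg_add_eq_sub] using this

theorem zero_mem_lipUnitBall (p : PseudoMetric X ℝ) : (0 : X →ᵇ ℝ) ∈ lipUnitBall p :=
  ⟨fun x => by simp, fun x y => by simpa using p.nonneg x y⟩

end Pseudometrics

section Measures

variable {X : Type*} [TopologicalSpace X] [MeasurableSpace X]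

/-- A signed measure is Radon if its total variation is inner regular with respect to compact sets
on all Borel sets. -/
def IsRadon (μ : SignedMeasure X) : Prop :=
  ∀ B : Set X, MeasurableSet B → ∀ ε : ℝ≥0∞, 0 < ε →
    ∃ K : Set X, IsCompact K ∧ K ⊆ B ∧ μ.totalVariation (B \ K) < ε

theorem IsRadon.add {μ ν : SignedMeasure X} (hμ : IsRadon μ) (hν : IsRadon ν) :
    IsRadon (μ + ν) := by
  intro B hB ε hε
  have h2 : 0 < ε / 2 := ENNReal.half_pos hε.ne'
  obtain ⟨K, hK, hKB, hKε⟩ := hμ B hB _ h2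
  obtain ⟨L, hL, hLB, hLε⟩ := hν B hB _ h2
  refine ⟨K ∪ L, hK.union hL, Set.union_subset hKB hLB, ?_⟩
  have h : (μ + ν).totalVariation ≤ μ.totalVariation + ν.totalVariation := by
    simp only [SignedMeasure.totalVariation_eq_variation]
    exact VectorMeasure.variation_add_le
  calc (μ + ν).totalVariation (B \ (K ∪ L))
      ≤ μ.totalVariation (B \ (K ∪ L)) + ν.totalVariation (B \ (K ∪ L)) := h _
    _ ≤ μ.totalVariation (B \ K) + ν.totalVariation (B \ L) := by
        gcongr
        · exact Set.subset_union_left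
        · exact Set.subset_union_right
    _ < ε / 2 + ε / 2 := ENNReal.add_lt_add hKε hLε
    _ = ε := ENNReal.add_halves ε

theorem IsRadon.zero : IsRadon (0 : SignedMeasure X) := fun B _ ε hε =>
  ⟨∅, isCompact_empty, Set.empty_subset B, by simpa [SignedMeasure.totalVariation_zero] using hε⟩

theorem IsRadon.smul (c : ℝ) {μ : SignedMeasure X} (hμ : IsRadon μ) : IsRadon (c • μ) := by
  intro B hB ε hε
  obtain ⟨K, hK, hKB, hKε⟩ := hμ B hB (ε / (‖c‖₊ + 1))
    (ENNReal.div_pos hε.ne' (by finiteness))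
  refine ⟨K, hK, hKB, ?_⟩
  have h : (c • μ).totalVariation (B \ K) = ‖c‖₊ * μ.totalVariation (B \ K) := by
    simp only [SignedMeasure.totalVariation_eq_variation, VectorMeasure.variation_smul]
    rfl
  rw [h]
  calc (‖c‖₊ : ℝ≥0∞) * μ.totalVariation (B \ K)
      ≤ (‖c‖₊ + 1) * μ.totalVariation (B \ K) := by gcongr; exact le_self_add
    _ < ε := by
        rw [mul_comm]
        exact (ENNReal.lt_div_iff_mul_lt (by simp) (by simp)).1 hKε

variable (X) in
/-- The real vector space of signed Radon measures on `X`. -/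
def radonMeasures : Submodule ℝ (SignedMeasure X) where
  carrier := {μ | IsRadon μ}
  add_mem' := IsRadon.add
  zero_mem' := IsRadon.zero
  smul_mem' c _ := IsRadon.smul c

instance isFiniteMeasure_variation (μ : SignedMeasure X) : IsFiniteMeasure μ.variation := by
  rw [← SignedMeasure.totalVariation_eq_variation]
  infer_instance

variable [OpensMeasurableSpace X]

theorem integrable_bcf (f : X →ᵇ ℝ) (μ : SignedMeasure X) : μ.Integrable f :=
  f.integrable μ.variation

/-- The functional `μ ↦ ∫ f dμ` on signed Radon measures, for a bounded continuous `f`. -/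
def integralFunctional (f : X →ᵇ ℝ) : radonMeasures X →ₗ[ℝ] ℝ where
  toFun μ := (μ : SignedMeasure X).integral f (ContinuousLinearMap.lsmul ℝ ℝ)
  map_add' μ ν := VectorMeasure.integral_add_vectorMeasure
    (integrable_bcf f μ) (integrable_bcf f ν)
  map_smul' c _ := VectorMeasure.integral_smul_vectorMeasure (⇑f) c

variable (X) in
/-- The weak topology on signed Radon measures, generated by the seminorms `μ ↦ |∫ f dμ|` with
`f` bounded and continuous. -/
@[reducible]
def weakTopology : TopologicalSpace (radonMeasures X) :=
  seminormTopology
    (Set.range fun f : X →ᵇ ℝ => (normSeminorm ℝ ℝ).comp (integralFunctional f))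

/-- `‖μ‖_{KR,p}`, the supremum of `∫ f dμ` over the `1`-Lipschitz functions with `|f| ≤ 1`. -/
def krNorm (p : PseudoMetric X ℝ) (μ : radonMeasures X) : ℝ :=
  sSup ((fun f => integralFunctional f μ) '' lipUnitBall p)

theorem bddAbove_krNorm (p : PseudoMetric X ℝ) (μ : radonMeasures X) :
    BddAbove ((fun f => integralFunctional f μ) '' lipUnitBall p) := by
  refine ⟨1 * ‖ContinuousLinearMap.lsmul ℝ ℝ (E := ℝ)‖ *
    (μ : SignedMeasure X).variation.real Set.univ, ?_⟩
  rintro _ ⟨f, hf, rfl⟩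
  have h := VectorMeasure.norm_integral_le_of_norm_le_const (μ := (μ : SignedMeasure X))
    (B := ContinuousLinearMap.lsmul ℝ ℝ) (f := ⇑f) (C := 1) (Filter.Eventually.of_forall hf.1)
  exact (le_abs_self _).trans h

theorem integralFunctional_neg (f : X →ᵇ ℝ) (μ : radonMeasures X) :
    integralFunctional (-f) μ = -integralFunctional f μ :=
  VectorMeasure.integral_neg (⇑f) (μ : SignedMeasure X) (ContinuousLinearMap.lsmul ℝ ℝ)

theorem le_krNorm {p : PseudoMetric X ℝ} {f : X →ᵇ ℝ} (hf : f ∈ lipUnitBall p)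
    (μ : radonMeasures X) : |integralFunctional f μ| ≤ krNorm p μ := by
  refine abs_le'.2 ⟨le_csSup (bddAbove_krNorm p μ) ⟨f, hf, rfl⟩, ?_⟩
  rw [← integralFunctional_neg]
  exact le_csSup (bddAbove_krNorm p μ) ⟨-f, neg_mem_lipUnitBall hf, rfl⟩

theorem krNorm_le {p : PseudoMetric X ℝ} {μ : radonMeasures X} {a : ℝ}
    (h : ∀ f ∈ lipUnitBall p, integralFunctional f μ ≤ a) : krNorm p μ ≤ a := by
  refine csSup_le ⟨_, 0, zero_mem_lipUnitBall p, rfl⟩ ?_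
  rintro _ ⟨f, hf, rfl⟩
  exact h f hf

/-- The Kantorovich–Rubinstein seminorm `‖·‖_{KR,p}` on signed Radon measures. -/
def krSeminorm (p : PseudoMetric X ℝ) : Seminorm ℝ (radonMeasures X) :=
  Seminorm.ofSMulLE (krNorm p)
    (le_antisymm (krNorm_le fun f _ => by simp)
      ((abs_nonneg _).trans (le_krNorm (zero_mem_lipUnitBall p) 0)))
    (fun μ ν => krNorm_le fun f hf => by
      rw [map_add]
      exact add_le_add ((le_abs_self _).trans (le_krNorm hf μ))
        ((le_abs_self _).trans (le_krNorm hf ν)))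
    (fun c μ => krNorm_le fun f hf => by
      rw [map_smul, smul_eq_mul, Real.norm_eq_abs]
      refine (le_abs_self _).trans ?_
      rw [abs_mul]
      exact mul_le_mul_of_nonneg_left (le_krNorm hf μ) (abs_nonneg c))

/-- The Kantorovich–Rubinstein topology generated by the seminorms `‖·‖_{KR,p}`, `p ∈ P`. -/
@[reducible]
def krTopology (P : Set (PseudoMetric X ℝ)) : TopologicalSpace (radonMeasures X) :=
  seminormTopology (krSeminorm '' P)

end Measures

/-- Two topologies on `E` induce the same topology on the subset `S`. -/
def CoincideOn {E : Type*} (t₁ t₂ : TopologicalSpace E) (S : Set E) : Prop :=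
  TopologicalSpace.induced ((↑) : S → E) t₁ = TopologicalSpace.induced ((↑) : S → E) t₂

end

end KantorovichRubinstein

namespace KantorovichRubinstein

noncomputable section

open Filter Set

/-! ### Integration against signed Radon measures. -/

section Integral

variable {X : Type*} [MeasurableSpace X]

/-! On a weakly compact set it suffices that the identity is continuous into a Hausdorff topology
(`coincideOn_of_isCompact`). The Kantorovich–Rubinstein topology is Hausdorff because Lipschitz
bumps around compact sets determine a Radon measure (`eq_zero_of_krNorm_eq_zero`).

For continuity (`tendsto_krNorm_of_weaklyCompact`), suppose `ν → μ` weakly along an ultrafilter on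
`S` while `krNorm p (ν - μ) ≥ ε`. Almost optimal test functions `f ν` have a pointwise limit `g` in
the same unit ball, and by equicontinuity the convergence is uniform on compact sets. Since `∫ g d(ν
- μ) → 0`, the functions `u ν = (f ν - g) / 2` still have integrals bounded below, yet become small
on every compact set. Truncating `u ν` where it is small and localizing it near a compact set
carrying most of `ν - μ` gives a hump (`exists_hump`) that avoids any finite number of earlier
compact sets.

An inductive choice yields humps with uniformly separated supports, so their sum is bounded and
continuous (`exists_sum_of_separated`), and its integrals against `ν k - μ` stay bounded below. At a
weak cluster point each single hump integrates to zero, hence so does the sum by dominated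
convergence: a contradiction (`false_of_slidingHump`). -/

theorem abs_integral_le_variation (μ : SignedMeasure X) {f : X → ℝ} {A : Set X}
    (hA : MeasurableSet A) (hf : ∀ x ∈ A, |f x| ≤ 1) (hf' : ∀ x ∉ A, f x = 0) :
    |μ.integral f (ContinuousLinearMap.lsmul ℝ ℝ)| ≤ μ.variation.real A := by
  have h := VectorMeasure.norm_integral_le_lintegral_norm (μ := μ) (f := f)
    (B := ContinuousLinearMap.lsmul ℝ ℝ (E := ℝ))
  rw [Real.norm_eq_abs] at h
  have h1 : ‖ContinuousLinearMap.lsmul ℝ ℝ (E := ℝ)‖ ≤ 1 := ContinuousLinearMap.opNorm_lsmul_le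
  have h2 : (∫⁻ a, ENNReal.ofReal ‖f a‖ ∂μ.variation) ≤ μ.variation A := by
    rw [← lintegral_indicator_one hA]
    refine lintegral_mono fun x => ?_
    by_cases hx : x ∈ A
    · simpa [hx] using hf x hx
    · simp [hx, hf' x hx]
  have h3 := ENNReal.toReal_mono (measure_ne_top μ.variation A) h2
  calc _ ≤ _ := h
    _ ≤ 1 * μ.variation.real A := by
      gcongr
      exact h3
    _ = _ := one_mul _

theorem integral_indicator_one (μ : SignedMeasure X) {A : Set X} (hA : MeasurableSet A) :
    μ.integral (A.indicator fun _ => (1 : ℝ)) (ContinuousLinearMap.lsmul ℝ ℝ) = μ A := by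
  have : IsFiniteMeasure (μ.restrict A).variation := isFiniteMeasure_variation (μ.restrict A)
  rw [VectorMeasure.integral_indicator hA, VectorMeasure.integral_const]
  simp [VectorMeasure.restrict_apply μ hA MeasurableSet.univ]

variable [TopologicalSpace X]

theorem exists_compact_variation_lt (μ : radonMeasures X) {B : Set X}
    (hB : MeasurableSet B) {ε : ℝ} (hε : 0 < ε) :
    ∃ K : Set X, IsCompact K ∧ K ⊆ B ∧ (μ : SignedMeasure X).variation.real (B \ K) < ε := by
  obtain ⟨K, hK, hKB, h⟩ := μ.2 B hB (ENNReal.ofReal ε) (ENNReal.ofReal_pos.2 hε)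
  refine ⟨K, hK, hKB, ?_⟩
  rw [SignedMeasure.totalVariation_eq_variation] at h
  exact (ENNReal.lt_ofReal_iff_toReal_lt (measure_ne_top _ _)).1 h

variable [OpensMeasurableSpace X]

theorem abs_integralFunctional_le (μ : radonMeasures X) {f : X →ᵇ ℝ} {A : Set X}
    (hA : MeasurableSet A) (hf : ∀ x, |f x| ≤ 1) (hf' : ∀ x ∉ A, f x = 0) :
    |integralFunctional f μ| ≤ (μ : SignedMeasure X).variation.real A :=
  abs_integral_le_variation _ hA (fun x _ => hf x) hf'

/-- The functional `f ↦ ∫ f dμ` on bounded continuous functions. -/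
def integralCLM (μ : radonMeasures X) : (X →ᵇ ℝ) →L[ℝ] ℝ :=
  LinearMap.mkContinuous
    { toFun := fun f => integralFunctional f μ
      map_add' := fun f g => VectorMeasure.integral_add (integrable_bcf f μ) (integrable_bcf g μ)
      map_smul' := fun c f => VectorMeasure.integral_smul (⇑f) (μ : SignedMeasure X)
        (ContinuousLinearMap.lsmul ℝ ℝ) c }
    (‖ContinuousLinearMap.lsmul ℝ ℝ (E := ℝ)‖ * (μ : SignedMeasure X).variation.real univ)
    fun f => by
      have h := VectorMeasure.norm_integral_le_of_norm_le_const (μ := (μ : SignedMeasure X))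
        (B := ContinuousLinearMap.lsmul ℝ ℝ) (f := ⇑f)
        (Eventually.of_forall f.norm_coe_le_norm)
      refine h.trans (le_of_eq ?_)
      ring

theorem integralCLM_apply (μ : radonMeasures X) (f : X →ᵇ ℝ) :
    integralCLM μ f = integralFunctional f μ := rfl

theorem integralFunctional_sub (f g : X →ᵇ ℝ) (μ : radonMeasures X) :
    integralFunctional (f - g) μ = integralFunctional f μ - integralFunctional g μ := by
  simp only [← integralCLM_apply, map_sub]

theorem integralFunctional_smul (c : ℝ) (f : X →ᵇ ℝ) (μ : radonMeasures X) :
    integralFunctional (c • f) μ = c * integralFunctional f μ := by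
  simp only [← integralCLM_apply, map_smul, smul_eq_mul]

theorem integralFunctional_sum {ι : Type*} (s : Finset ι) (f : ι → X →ᵇ ℝ) (μ : radonMeasures X) :
    integralFunctional (∑ i ∈ s, f i) μ = ∑ i ∈ s, integralFunctional (f i) μ := by
  simp only [← integralCLM_apply, map_sum]

end Integral

/-! ### Topologies generated by seminorms, and comparison on a compact set. -/

section SeminormTopology

/-- A continuous bijection from a compact space to a Hausdorff space is a homeomorphism, so only one
direction of convergence needs checking, and ultrafilters suffice for it. -/
theorem coincideOn_of_isCompact {E : Type*} {t₁ t₂ : TopologicalSpace E} {S : Set E}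
    (hS : @IsCompact E t₁ S) (h₂ : @T2Space E t₂)
    (h : ∀ a ∈ S, ∀ F : Ultrafilter E, S ∈ F → ↑F ≤ @nhds E t₁ a → ↑F ≤ @nhds E t₂ a) :
    CoincideOn t₁ t₂ S := by
  let s₁ : TopologicalSpace S := .induced (↑) t₁
  let s₂ : TopologicalSpace S := .induced (↑) t₂
  have hc : @CompactSpace S s₁ := @isCompact_iff_compactSpace E t₁ S |>.1 hS
  have ht : @T2Space S s₂ := @T2Space.of_injective_continuous S E s₂ t₂ _
    _ Subtype.val_injective continuous_induced_dom
  have hle : s₁ ≤ s₂ := by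
    rw [le_iff_nhds]
    intro a
    rw [@nhds_induced E S t₁, @nhds_induced E S t₂, ← tendsto_iff_comap,
      tendsto_iff_ultrafilter]
    intro F hF
    have hF' : Tendsto ((↑) : S → E) F (@nhds E t₁ a) := tendsto_iff_comap.2 hF
    refine h a a.2 (F.map Subtype.val) ?_ hF'
    exact Ultrafilter.mem_map.2 (univ_mem' fun x => x.2)
  have hcont : @Continuous S S s₁ s₂ id := continuous_id_iff_le.2 hle
  refine le_antisymm hle ?_
  exact continuous_id_iff_le.1
    (@Continuous.continuous_symm_of_equiv_compact_to_t2 S S s₁ s₂ hc ht (Equiv.refl S) hcont)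

variable {E : Type*} [AddCommGroup E] [Module ℝ E]

theorem tendsto_seminormTopology_iff {ι : Type*} {Q : Set (Seminorm ℝ E)} {l : Filter ι}
    {u : ι → E} {a : E} :
    Tendsto u l (@nhds E (seminormTopology Q) a) ↔
      ∀ q ∈ Q, Tendsto (fun i => q (u i - a)) l (𝓝 0) := by
  simp only [nhds_iInf, tendsto_iInf]
  refine forall₂_congr fun q _ => ?_
  let := q.toSeminormedAddCommGroup
  exact tendsto_iff_norm_sub_tendsto_zero

theorem t2Space_seminormTopology {Q : Set (Seminorm ℝ E)}
    (hQ : ∀ x : E, (∀ q ∈ Q, q x = 0) → x = 0) : @T2Space E (seminormTopology Q) := by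
  let := seminormTopology Q
  refine t2_iff_nhds.2 fun {x y} hxy => ?_
  have hx := (tendsto_seminormTopology_iff (u := id) (a := x) (Q := Q) (l := 𝓝 x ⊓ 𝓝 y)).1
    (tendsto_id'.2 inf_le_left)
  have hy := (tendsto_seminormTopology_iff (u := id) (a := y) (Q := Q) (l := 𝓝 x ⊓ 𝓝 y)).1
    (tendsto_id'.2 inf_le_right)
  refine (sub_eq_zero.1 (hQ (x - y) fun q hq => le_antisymm ?_ (apply_nonneg q _)))
  refine ge_of_tendsto' (by simpa using (hx q hq).add (hy q hq)) fun z => ?_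
  calc q (x - y) = q ((z - y) - (z - x)) := by congr 1; abel
    _ ≤ q (z - y) + q (z - x) := map_sub_le_add q _ _
    _ = q (id z - x) + q (id z - y) := add_comm _ _

end SeminormTopology

/-! ### Lipschitz bump functions around a set. -/

section Bump

variable {X : Type*}

/-- A function equal to `1` on `K` and vanishing at `p`-distance at least `r` from `K`. -/
def bump (p : PseudoMetric X ℝ) (K : Set X) (r : ℝ) (x : X) : ℝ :=
  ⨆ y : K, max 0 (1 - p x y / r)

variable {p : PseudoMetric X ℝ} {K : Set X} {r : ℝ}

theorem max_zero_one_sub_le_one (hr : 0 < r) (x y : X) : max 0 (1 - p x y / r) ≤ 1 := by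
  have := div_nonneg (p.nonneg x y) hr.le
  exact max_le zero_le_one (by linarith)

theorem bddAbove_bump (hr : 0 < r) (x : X) :
    BddAbove (range fun y : K => max 0 (1 - p x y / r)) :=
  ⟨1, by rintro _ ⟨y, rfl⟩; exact max_zero_one_sub_le_one hr x y⟩

theorem bump_nonneg (x : X) : 0 ≤ bump p K r x :=
  Real.iSup_nonneg fun _ => le_max_left _ _

theorem bump_le_one (hr : 0 < r) (x : X) : bump p K r x ≤ 1 :=
  Real.iSup_le (fun y => max_zero_one_sub_le_one hr x y) zero_le_one

theorem abs_bump_le_one (hr : 0 < r) (x : X) : |bump p K r x| ≤ 1 :=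
  abs_le.2 ⟨by linarith [bump_nonneg (p := p) (K := K) (r := r) x], bump_le_one hr x⟩

theorem bump_eq_one (hr : 0 < r) {x : X} (hx : x ∈ K) : bump p K r x = 1 := by
  refine le_antisymm (bump_le_one hr x) ?_
  have := le_ciSup (bddAbove_bump (p := p) (K := K) hr x) ⟨x, hx⟩
  exact le_trans (by simp [p.refl]) this

theorem exists_lt_of_bump_ne_zero (hr : 0 < r) {x : X} (hx : bump p K r x ≠ 0) :
    ∃ y ∈ K, p x y < r := by
  by_contra! h
  refine hx (le_antisymm (Real.iSup_le (fun y => max_le le_rfl ?_) le_rfl) (bump_nonneg x))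
  have := (one_le_div hr).2 (h y y.2)
  linarith

theorem bump_sub_le (hr : 0 < r) (x y : X) :
    bump p K r x - bump p K r y ≤ r⁻¹ * p x y := by
  have h0 : 0 ≤ r⁻¹ * p x y := mul_nonneg (inv_nonneg.2 hr.le) (p.nonneg x y)
  rw [sub_le_iff_le_add]
  refine Real.iSup_le (fun z => ?_) (add_nonneg h0 (bump_nonneg y))
  have h1 := le_ciSup (bddAbove_bump (p := p) (K := K) hr y) z
  have h2 : p y z / r ≤ r⁻¹ * p x y + p x z / r := by
    rw [div_eq_inv_mul, div_eq_inv_mul, ← mul_add]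
    refine mul_le_mul_of_nonneg_left ?_ (inv_nonneg.2 hr.le)
    rw [p.symm x y]
    exact p.triangle y x z
  have h3 := le_max_left 0 (1 - p y z / r)
  have h4 := le_max_right 0 (1 - p y z / r)
  unfold bump
  refine max_le ?_ ?_ <;> linarith

theorem abs_bump_sub_le (hr : 0 < r) (x y : X) :
    |bump p K r x - bump p K r y| ≤ r⁻¹ * p x y := by
  refine abs_sub_le_iff.2 ⟨bump_sub_le hr x y, ?_⟩
  rw [p.symm]
  exact bump_sub_le hr y x

end Bump

/-! ### Continuous pseudometrics and their Lipschitz functions. -/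

section ContinuousPseudometric

theorem abs_sub_le_add {X : Type*} (p : PseudoMetric X ℝ) (x y x' y' : X) :
    |p x y - p x' y'| ≤ p x' x + p y' y := by
  refine abs_sub_le_iff.2 ⟨?_, ?_⟩
  · have h1 := p.triangle x x' y
    have h2 := p.triangle x' y' y
    rw [p.symm x x'] at h1
    linarith
  · have h1 := p.triangle x' x y'
    have h2 := p.triangle x y y'
    rw [p.symm y y'] at h2
    linarith

variable {X : Type*} [TopologicalSpace X]

theorem eventually_lt_of_continuous {p : PseudoMetric X ℝ}
    (hp : p ∈ continuousPseudometrics X) (x : X) {r : ℝ} (hr : 0 < r) : ∀ᶠ y in 𝓝 x, p x y < r := by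
  have h : Continuous fun y => p x y :=
    (show Continuous fun z : X × X => p z.1 z.2 from hp).comp (by fun_prop : Continuous (x, ·))
  have := h.tendsto x
  rw [p.refl] at this
  exact this.eventually_lt_const hr

/-- The Lipschitz bound is required only at scales below `r`: this is all that a sum of separated
humps satisfies. -/
theorem continuous_of_uniform {p : PseudoMetric X ℝ} (hp : p ∈ continuousPseudometrics X)
    {f : X → ℝ} {C r : ℝ} (hC : 0 ≤ C) (hr : 0 < r)
    (hf : ∀ x y, p x y < r → |f x - f y| ≤ C * p x y) : Continuous f := by
  refine continuous_iff_continuousAt.2 fun x => Metric.tendsto_nhds.2 fun ε hε => ?_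
  have hδ : 0 < min r (ε / (C + 1)) := lt_min hr (by positivity)
  filter_upwards [eventually_lt_of_continuous hp x hδ] with y hy
  rw [dist_comm, Real.dist_eq]
  have h2 : (C + 1) * p x y < ε := by
    rw [mul_comm]
    exact (lt_div_iff₀ (by positivity)).1 (hy.trans_le (min_le_right _ _))
  have h1 := hf x y (hy.trans_le (min_le_left _ _))
  nlinarith [p.nonneg x y]

/-- A bounded function that is Lipschitz for a continuous pseudometric, as a bounded continuous
function. -/
def lipschitzBCF {p : PseudoMetric X ℝ} (hp : p ∈ continuousPseudometrics X)
    (f : X → ℝ) {B C r : ℝ} (hB : ∀ x, |f x| ≤ B) (hC : 0 ≤ C) (hr : 0 < r)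
    (hf : ∀ x y, p x y < r → |f x - f y| ≤ C * p x y) : X →ᵇ ℝ :=
  BoundedContinuousFunction.ofNormedAddCommGroup f (continuous_of_uniform hp hC hr hf) B hB

@[simp]
theorem lipschitzBCF_apply {p : PseudoMetric X ℝ} (hp : p ∈ continuousPseudometrics X)
    (f : X → ℝ) {B C r : ℝ} (hB : ∀ x, |f x| ≤ B) (hC : 0 ≤ C) (hr : 0 < r)
    (hf : ∀ x y, p x y < r → |f x - f y| ≤ C * p x y) (x : X) :
    lipschitzBCF hp f hB hC hr hf x = f x := rfl

theorem mem_continuousPseudometrics_of_eventually {p : PseudoMetric X ℝ}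
    (h : ∀ x, ∀ r > 0, ∀ᶠ y in 𝓝 x, p x y < r) : p ∈ continuousPseudometrics X := by
  refine continuous_iff_continuousAt.2 fun ⟨x, y⟩ => Metric.tendsto_nhds.2 fun ε hε => ?_
  rw [nhds_prod_eq]
  filter_upwards [(h x (ε / 2) (half_pos hε)).prod_mk (h y (ε / 2) (half_pos hε))] with z hz
  rw [Real.dist_eq]
  have := abs_sub_le_add p z.1 z.2 x y
  linarith [hz.1, hz.2]

theorem sup_mem_continuousPseudometrics {p q : PseudoMetric X ℝ}
    (hp : p ∈ continuousPseudometrics X) (hq : q ∈ continuousPseudometrics X) :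
    p ⊔ q ∈ continuousPseudometrics X :=
  mem_continuousPseudometrics_of_eventually fun x r hr => by
    filter_upwards [eventually_lt_of_continuous hp x hr, eventually_lt_of_continuous hq x hr]
      with y h1 h2
    exact max_lt h1 h2

variable (X) in
theorem isDirectedFamily_continuousPseudometrics :
    IsDirectedFamily (continuousPseudometrics X) :=
  ⟨⟨⊥, continuous_const⟩, fun p hp q hq => ⟨p ⊔ q, sup_mem_continuousPseudometrics hp hq, 1,
    fun x y => by simp⟩⟩

/-- The pseudometric `|f x - f y|`. -/
def absSubPseudometric (f : X → ℝ) : PseudoMetric X ℝ where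
  toFun x y := |f x - f y|
  refl' x := by simp
  symm' x y := abs_sub_comm _ _
  triangle' x y z := abs_sub_le _ _ _

variable (X) in
theorem generatesTopology_continuousPseudometrics [CompletelyRegularSpace X] :
    GeneratesTopology (continuousPseudometrics X) := by
  refine le_antisymm (le_generateFrom ?_) fun U hU => ?_
  · rintro _ ⟨p, hp, x, r, -, rfl⟩
    have h : Continuous fun y => p x y :=
      (show Continuous fun z : X × X => p z.1 z.2 from hp).comp (by fun_prop : Continuous (x, ·))
    exact isOpen_lt h continuous_const
  · refine (@isOpen_iff_forall_mem_open X (TopologicalSpace.generateFrom _) U).2 fun x hx => ?_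
    obtain ⟨f, hf, hfx, hfU⟩ := CompletelyRegularSpace.completely_regular x Uᶜ
      (isClosed_compl_iff.2 hU) (by simpa using hx)
    have hc : Continuous fun y => (f y : ℝ) := continuous_subtype_val.comp hf
    refine ⟨{y | absSubPseudometric (fun y => (f y : ℝ)) x y < 1}, fun y hy => ?_, ?_, ?_⟩
    · by_contra hyU
      have h1 : f y = 1 := hfU hyU
      have h2 : |(f x : ℝ) - f y| < 1 := hy
      simp [hfx, h1] at h2
    · refine TopologicalSpace.isOpen_generateFrom_of_mem ⟨_, ?_, x, 1, one_pos, rfl⟩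
      show Continuous fun z : X × X => |(f z.1 : ℝ) - f z.2|
      fun_prop
    · show |(f x : ℝ) - f x| < 1
      simp

end ContinuousPseudometric

/-! ### Generating directed families and the Hausdorff property. -/

section Generating

theorem IsDirectedFamily.exists_le {X : Type*} {P : Set (PseudoMetric X ℝ)} (hP : IsDirectedFamily P)
    {p q : PseudoMetric X ℝ} (hp : p ∈ P) (hq : q ∈ P) {r s : ℝ} (hr : 0 < r) (hs : 0 < s) :
    ∃ p' ∈ P, ∃ δ > 0, ∀ x y, p' x y < δ → p x y < r ∧ q x y < s := by
  obtain ⟨p', hp', C, hC⟩ := hP.2 p hp q hq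
  have hC' : 0 < |C| + 1 := by positivity
  refine ⟨p', hp', min r s / (|C| + 1), div_pos (lt_min hr hs) hC', fun x y hxy => ?_⟩
  have h1 := (lt_div_iff₀ hC').1 hxy
  have h2 : C * p' x y ≤ p' x y * (|C| + 1) := by
    nlinarith [p'.nonneg x y, le_abs_self C]
  exact ⟨((hC x y).1.trans h2).trans_lt (h1.trans_le (min_le_left _ _)),
    ((hC x y).2.trans h2).trans_lt (h1.trans_le (min_le_right _ _))⟩

variable {X : Type*} [t : TopologicalSpace X] {P : Set (PseudoMetric X ℝ)}

theorem GeneratesTopology.subset_continuousPseudometrics (hP : GeneratesTopology P) :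
    P ⊆ continuousPseudometrics X := fun p hp =>
  mem_continuousPseudometrics_of_eventually fun x r hr => by
    refine IsOpen.mem_nhds (s := {y | p x y < r}) ?_ (by simpa [p.refl] using hr)
    rw [GeneratesTopology] at hP
    rw [hP]
    exact TopologicalSpace.isOpen_generateFrom_of_mem ⟨p, hp, x, r, hr, rfl⟩

/-- Directedness turns the subbase of balls into a base: finite intersections of balls contain a
ball of a single member of `P`. -/
theorem exists_ball_subset (hP : GeneratesTopology P) (hd : IsDirectedFamily P) {U : Set X}
    (hU : IsOpen U) {x : X} (hx : x ∈ U) : ∃ p ∈ P, ∃ r > 0, {y | p x y < r} ⊆ U := by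
  rw [GeneratesTopology] at hP
  rw [hP] at hU
  induction hU with
  | basic s hs =>
    obtain ⟨p, hp, z, r, hr, rfl⟩ := hs
    refine ⟨p, hp, r - p z x, sub_pos.2 hx, fun y hy => ?_⟩
    have h1 := p.triangle z x y
    have h2 : p x y < r - p z x := hy
    show p z y < r
    linarith
  | univ =>
    obtain ⟨p, hp⟩ := hd.1
    exact ⟨p, hp, 1, one_pos, subset_univ _⟩
  | inter s s' _ _ ih ih' =>
    obtain ⟨p, hp, r, hr, h⟩ := ih hx.1
    obtain ⟨q, hq, r', hr', h'⟩ := ih' hx.2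
    obtain ⟨p', hp', δ, hδ, H⟩ := hd.exists_le hp hq hr hr'
    exact ⟨p', hp', δ, hδ, fun y hy => ⟨h (H x y hy).1, h' (H x y hy).2⟩⟩
  | sUnion S _ ih =>
    obtain ⟨s, hs, hxs⟩ := hx
    obtain ⟨p, hp, r, hr, h⟩ := ih s hs hxs
    exact ⟨p, hp, r, hr, h.trans (subset_sUnion_of_mem hs)⟩

/-- A Lebesgue number argument: halving the radius at each point makes it uniform nearby, and
compactness with directedness merges finitely many choices. -/
theorem exists_thickening_subset (hP : GeneratesTopology P) (hd : IsDirectedFamily P) {K U : Set X}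
    (hK : IsCompact K) (hU : IsOpen U) (hKU : K ⊆ U) :
    ∃ p ∈ P, ∃ r > 0, ∀ x ∈ K, {y | p x y < r} ⊆ U := by
  refine hK.induction_on (p := fun s => ∃ p ∈ P, ∃ r > 0, ∀ x ∈ s, {y | p x y < r} ⊆ U) ?_ ?_ ?_ ?_
  · obtain ⟨p, hp⟩ := hd.1
    exact ⟨p, hp, 1, one_pos, by simp⟩
  · rintro s s' hs ⟨p, hp, r, hr, h⟩
    exact ⟨p, hp, r, hr, fun x hx => h x (hs hx)⟩
  · rintro s s' ⟨p, hp, r, hr, h⟩ ⟨q, hq, r', hr', h'⟩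
    obtain ⟨p', hp', δ, hδ, H⟩ := hd.exists_le hp hq hr hr'
    refine ⟨p', hp', δ, hδ, ?_⟩
    rintro x (hx | hx) y hy
    · exact h x hx (H x y hy).1
    · exact h' x hx (H x y hy).2
  · intro x hx
    obtain ⟨p, hp, r, hr, h⟩ := exists_ball_subset hP hd hU (hKU hx)
    refine ⟨{y | p x y < r / 2}, mem_nhdsWithin_of_mem_nhds (eventually_lt_of_continuous
      (hP.subset_continuousPseudometrics hp) x (half_pos hr)), p, hp, r / 2, half_pos hr, ?_⟩
    intro y hy z hz
    refine h ?_
    have := p.triangle x y z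
    have h1 : p x y < r / 2 := hy
    have h2 : p y z < r / 2 := hz
    show p x z < r
    linarith

variable [MeasurableSpace X] [BorelSpace X]

theorem integralFunctional_eq_zero_of_krNorm_eq_zero {p : PseudoMetric X ℝ} {μ : radonMeasures X}
    (hμ : krNorm p μ = 0) {f : X →ᵇ ℝ} {C : ℝ} (hf : ∀ x, |f x| ≤ 1)
    (hC : ∀ x y, |f x - f y| ≤ C * p x y) : integralFunctional f μ = 0 := by
  have hc : 0 < |C| + 1 := by positivity
  have hmem : (|C| + 1)⁻¹ • f ∈ lipUnitBall p := by
    refine ⟨fun x => ?_, fun x y => ?_⟩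
    · simp only [BoundedContinuousFunction.coe_smul, smul_eq_mul]
      rw [abs_mul, abs_of_pos (inv_pos.2 hc),
        inv_mul_le_iff₀ hc]
      linarith [hf x, abs_nonneg C]
    · simp only [BoundedContinuousFunction.coe_smul, smul_eq_mul]
      rw [← mul_sub, abs_mul, abs_of_pos (inv_pos.2 hc), inv_mul_le_iff₀ hc]
      nlinarith [hC x y, p.nonneg x y, le_abs_self C]
  have h := le_krNorm hmem μ
  rw [hμ, integralFunctional_smul] at h
  exact (mul_eq_zero.1 (abs_eq_zero.1 (le_antisymm h (abs_nonneg _)))).resolve_left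
    (inv_pos.2 hc).ne'

/-- A bump around `K` integrates to zero. If it also vanishes on a compact `L` filling `Kᶜ` up to
mass `ε`, it differs from the indicator of `K` only on `Kᶜ \ L`. -/
theorem apply_compact_eq_zero_of_krNorm_eq_zero [T2Space X] (hP : GeneratesTopology P)
    (hd : IsDirectedFamily P) {μ : radonMeasures X} (hμ : ∀ p ∈ P, krNorm p μ = 0) {K : Set X}
    (hK : IsCompact K) : (μ : SignedMeasure X) K = 0 := by
  refine abs_eq_zero.1 (le_antisymm (le_of_forall_pos_le_add fun ε hε => ?_) (abs_nonneg _))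
  obtain ⟨L, hL, hLK, hLε⟩ := exists_compact_variation_lt μ hK.measurableSet.compl hε
  obtain ⟨p, hp, r, hr, h⟩ := exists_thickening_subset hP hd hK hL.isClosed.isOpen_compl
    (fun x hx hxL => hLK hxL hx)
  let f : X →ᵇ ℝ := lipschitzBCF (hP.subset_continuousPseudometrics hp) (bump p K r)
    (abs_bump_le_one hr) (inv_nonneg.2 hr.le) hr fun x y _ => abs_bump_sub_le hr x y
  have hf : integralFunctional f μ = 0 := integralFunctional_eq_zero_of_krNorm_eq_zero (hμ p hp)
    (abs_bump_le_one hr) (abs_bump_sub_le hr)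
  have hi : (μ : SignedMeasure X).Integrable (K.indicator fun _ => (1 : ℝ)) :=
    (integrable_const (μ := (μ : SignedMeasure X).variation) (1 : ℝ)).indicator hK.measurableSet
  have hsub := VectorMeasure.integral_fun_sub (B := ContinuousLinearMap.lsmul ℝ ℝ)
    (integrable_bcf f μ) hi
  rw [integral_indicator_one _ hK.measurableSet] at hsub
  have hbd := abs_integral_le_variation (μ : SignedMeasure X)
    (f := fun x => f x - K.indicator (fun _ => (1 : ℝ)) x)
    (hK.measurableSet.compl.diff hL.measurableSet) ?_ ?_
  · rw [hsub, show (μ : SignedMeasure X).integral f (ContinuousLinearMap.lsmul ℝ ℝ) = 0 from hf,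
      zero_sub, abs_neg] at hbd
    linarith
  · rintro x ⟨hx, -⟩
    rw [indicator_of_notMem hx, sub_zero]
    exact abs_bump_le_one hr x
  · intro x hx
    by_cases hxK : x ∈ K
    · rw [indicator_of_mem hxK, sub_eq_zero]
      exact bump_eq_one hr hxK
    · rw [indicator_of_notMem hxK, sub_zero]
      by_contra hne
      obtain ⟨y, hy, hxy⟩ := exists_lt_of_bump_ne_zero hr hne
      rw [p.symm] at hxy
      exact hx ⟨hxK, fun hxL => h y hy hxy hxL⟩

theorem eq_zero_of_krNorm_eq_zero [T2Space X] (hP : GeneratesTopology P)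
    (hd : IsDirectedFamily P) {μ : radonMeasures X} (hμ : ∀ p ∈ P, krNorm p μ = 0) : μ = 0 := by
  refine Subtype.ext (VectorMeasure.ext fun B hB => ?_)
  refine abs_eq_zero.1 (le_antisymm (le_of_forall_pos_le_add fun ε hε => ?_) (abs_nonneg _))
  obtain ⟨K, hK, hKB, hKε⟩ := exists_compact_variation_lt μ hB hε
  have h1 := VectorMeasure.of_add_of_sdiff hK.measurableSet hB hKB (v := (μ : SignedMeasure X))
  rw [apply_compact_eq_zero_of_krNorm_eq_zero hP hd hμ hK, zero_add] at h1
  rw [← h1, zero_add]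
  exact (VectorMeasure.norm_measure_le_variation (μ := (μ : SignedMeasure X))).trans hKε.le

theorem t2Space_krTopology [T2Space X] (hP : GeneratesTopology P) (hd : IsDirectedFamily P) :
    @T2Space _ (krTopology P) :=
  t2Space_seminormTopology fun _ h =>
    eq_zero_of_krNorm_eq_zero hP hd fun _ hp => h _ (mem_image_of_mem _ hp)

end Generating

/-! ### Soft thresholding of real numbers. -/

section SoftThreshold

/-- Soft thresholding: `t` minus its truncation to `[-δ, δ]`. -/
def softThreshold (δ t : ℝ) : ℝ := t - max (-δ) (min δ t)

variable {δ : ℝ}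

theorem abs_softThreshold_sub_le (hδ : 0 ≤ δ) (t : ℝ) : |softThreshold δ t - t| ≤ δ := by
  unfold softThreshold
  grind

theorem softThreshold_eq_zero {t : ℝ} (ht : |t| ≤ δ) : softThreshold δ t = 0 := by
  unfold softThreshold
  grind

theorem abs_softThreshold_le (hδ : 0 ≤ δ) (t : ℝ) : |softThreshold δ t| ≤ |t| := by
  unfold softThreshold
  grind

theorem abs_softThreshold_sub_softThreshold_le (hδ : 0 ≤ δ) (s t : ℝ) :
    |softThreshold δ s - softThreshold δ t| ≤ |s - t| := by
  unfold softThreshold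
  grind

end SoftThreshold

/-! ### Localization, separated sums and limits of Lipschitz functions. -/

section Functions

variable {X : Type*} [TopologicalSpace X] {p : PseudoMetric X ℝ}

/-- Localization near `K` of a function `u` from the Lipschitz unit ball: up to `2 * η`, the
function `h` agrees with `u` on `K`; it vanishes away from `K` and wherever `u` is small. -/
theorem exists_localization (hp : p ∈ continuousPseudometrics X) {η : ℝ} (hη : 0 < η) (K : Set X)
    {u : X →ᵇ ℝ} (hu : u ∈ lipUnitBall p) :
    ∃ h v : X →ᵇ ℝ, (∀ x, |h x| ≤ 1) ∧ (∀ x y, |h x - h y| ≤ (1 + (η / 2)⁻¹) * p x y) ∧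
      (∀ x, h x ≠ 0 → ∃ y ∈ K, p x y < η / 2) ∧ (∀ x, h x ≠ 0 → 2 * η < |u x|) ∧
      (∀ x, |v x - u x| ≤ 2 * η) ∧ (∀ x, |h x - v x| ≤ 1) ∧ ∀ x ∈ K, h x = v x := by
  have h2 : 0 ≤ 2 * η := by positivity
  have hr : 0 < η / 2 := half_pos hη
  let V : X → ℝ := fun x => softThreshold (2 * η) (u x)
  let b : X → ℝ := bump p K (η / 2)
  have hV1 : ∀ x, |V x| ≤ 1 := fun x => (abs_softThreshold_le h2 _).trans (hu.1 x)
  have hVL : ∀ x y, |V x - V y| ≤ 1 * p x y := fun x y =>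
    (abs_softThreshold_sub_softThreshold_le h2 _ _).trans ((one_mul (p x y)).symm ▸ hu.2 x y)
  have hb0 : ∀ x, 0 ≤ b x := bump_nonneg
  have hb1 : ∀ x, b x ≤ 1 := bump_le_one hr
  have hbL : ∀ x y, |b x - b y| ≤ (η / 2)⁻¹ * p x y := abs_bump_sub_le hr
  have hH1 : ∀ x, |V x * b x| ≤ 1 := fun x => by
    rw [abs_mul, abs_of_nonneg (hb0 x)]
    exact mul_le_one₀ (hV1 x) (hb0 x) (hb1 x)
  have hHL : ∀ x y, |V x * b x - V y * b y| ≤ (1 + (η / 2)⁻¹) * p x y := fun x y => by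
    have e : V x * b x - V y * b y = V x * (b x - b y) + (V x - V y) * b y := by ring
    rw [e]
    refine (abs_add_le _ _).trans ?_
    rw [abs_mul, abs_mul, abs_of_nonneg (hb0 y)]
    have h3 : |V x| * |b x - b y| ≤ |b x - b y| :=
      mul_le_of_le_one_left (abs_nonneg _) (hV1 x)
    have h4 : |V x - V y| * b y ≤ |V x - V y| :=
      mul_le_of_le_one_right (abs_nonneg _) (hb1 y)
    linarith [hVL x y, hbL x y]
  refine ⟨lipschitzBCF hp (fun x => V x * b x) hH1 (by positivity) one_pos fun x y _ => hHL x y,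
    lipschitzBCF hp V hV1 zero_le_one one_pos fun x y _ => hVL x y, hH1, hHL, fun x hx => ?_,
    fun x hx => ?_, fun x => abs_softThreshold_sub_le h2 _, fun x => ?_, fun x hx => ?_⟩
  · exact exists_lt_of_bump_ne_zero hr (right_ne_zero_of_mul hx)
  · by_contra! hle
    exact left_ne_zero_of_mul hx (softThreshold_eq_zero hle)
  · have e : V x * b x - V x = -(V x * (1 - b x)) := by ring
    rw [lipschitzBCF_apply, lipschitzBCF_apply, e, abs_neg, abs_mul,
      abs_of_nonneg (sub_nonneg.2 (hb1 x))]
    exact mul_le_one₀ (hV1 x) (sub_nonneg.2 (hb1 x)) (by linarith [hb0 x])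
  · rw [lipschitzBCF_apply, lipschitzBCF_apply, show b x = 1 from bump_eq_one hr hx, mul_one]

/-- The sum of a uniformly Lipschitz sequence of functions with uniformly separated supports is
bounded and continuous. -/
theorem exists_sum_of_separated (hp : p ∈ continuousPseudometrics X) {h : ℕ → X →ᵇ ℝ} {C r : ℝ}
    (hC : 0 ≤ C) (hr : 0 < r) (h1 : ∀ n x, |h n x| ≤ 1)
    (hL : ∀ n x y, |h n x - h n y| ≤ C * p x y)
    (hsep : ∀ m n, m < n → ∀ x y, h m x ≠ 0 → h n y ≠ 0 → r ≤ p x y) :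
    ∃ g : X →ᵇ ℝ, ∀ x, ∃ k, g x = h k x ∧ ∀ j ≠ k, h j x = 0 := by
  have hsep' : ∀ m n, m ≠ n → ∀ x y, h m x ≠ 0 → h n y ≠ 0 → r ≤ p x y := by
    intro m n hmn x y hx hy
    rcases hmn.lt_or_gt with hlt | hlt
    · exact hsep m n hlt x y hx hy
    · rw [p.symm]
      exact hsep n m hlt y x hy hx
  -- Points closer than `r` meet at most one common hump, so the sum inherits the Lipschitz bound of
  -- that hump at this scale.
  have hloc : ∀ x y, p x y < r → ∃ k, ∀ j ≠ k, h j x = 0 ∧ h j y = 0 := by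
    intro x y hxy
    have hxx : p x x < r := by rwa [p.refl]
    have hyy : p y y < r := by rwa [p.refl]
    by_cases hex : ∃ k, h k x ≠ 0 ∨ h k y ≠ 0
    · obtain ⟨k, hk⟩ := hex
      refine ⟨k, fun j hj => ⟨?_, ?_⟩⟩ <;> by_contra hne <;> rcases hk with hk | hk
      · exact absurd (hsep' k j hj.symm x x hk hne) hxx.not_ge
      · exact absurd (hsep' j k hj x y hne hk) hxy.not_ge
      · exact absurd (hsep' k j hj.symm x y hk hne) hxy.not_ge
      · exact absurd (hsep' k j hj.symm y y hk hne) hyy.not_ge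
    · push Not at hex
      -- All humps vanish at both points, so any index would do.
      exact ⟨0, fun j _ => hex j⟩
  have hval : ∀ x k, (∀ j ≠ k, h j x = 0) → ∑' n, h n x = h k x := fun x k hk =>
    tsum_eq_single k hk
  have hpt : ∀ x, ∃ k, ∑' n, h n x = h k x ∧ ∀ j ≠ k, h j x = 0 := fun x => by
    obtain ⟨k, hk⟩ := hloc x x (by rwa [p.refl])
    exact ⟨k, hval x k fun j hj => (hk j hj).1, fun j hj => (hk j hj).1⟩
  have hb : ∀ x, |∑' n, h n x| ≤ 1 := fun x => by
    obtain ⟨k, hk, -⟩ := hpt x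
    rw [hk]
    exact h1 k x
  refine ⟨lipschitzBCF hp (fun x => ∑' n, h n x) hb hC hr fun x y hxy => ?_, hpt⟩
  obtain ⟨k, hk⟩ := hloc x y hxy
  rw [hval x k fun j hj => (hk j hj).1, hval y k fun j hj => (hk j hj).2]
  exact hL k x y

theorem exists_tendsto_of_lipUnitBall (hp : p ∈ continuousPseudometrics X) {ι : Type*}
    (F : Ultrafilter ι) {f : ι → X →ᵇ ℝ} (hf : ∀ i, f i ∈ lipUnitBall p) :
    ∃ g ∈ lipUnitBall p, ∀ x, Tendsto (fun i => f i x) F (𝓝 (g x)) := by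
  have hlim : ∀ x, ∃ a : ℝ, Tendsto (fun i => f i x) F (𝓝 a) := fun x => by
    obtain ⟨a, -, ha⟩ := (isCompact_Icc (a := (-1 : ℝ)) (b := 1)).ultrafilter_le_nhds'
      (F.map fun i => f i x)
      (Ultrafilter.mem_map.2 (univ_mem' fun i => abs_le.1 ((hf i).1 x)))
    exact ⟨a, ha⟩
  choose g hg using hlim
  have hb : ∀ x, |g x| ≤ 1 := fun x =>
    le_of_tendsto (hg x).abs (Eventually.of_forall fun i => (hf i).1 x)
  have hL : ∀ x y, |g x - g y| ≤ p x y := fun x y =>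
    le_of_tendsto ((hg x).sub (hg y)).abs (Eventually.of_forall fun i => (hf i).2 x y)
  exact ⟨lipschitzBCF hp g hb zero_le_one one_pos fun x y _ => (one_mul (p x y)).symm ▸ hL x y,
    ⟨hb, hL⟩, hg⟩

/-- The unit ball is equicontinuous, so pointwise convergence is locally uniform: on a `p`-ball of
radius `ε / 3`, the value at the centre controls the others. -/
theorem eventually_forall_compact_of_lipUnitBall (hp : p ∈ continuousPseudometrics X)
    {ι : Type*} {l : Filter ι} {f : ι → X →ᵇ ℝ} (hf : ∀ i, f i ∈ lipUnitBall p) {g : X →ᵇ ℝ}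
    (hg : g ∈ lipUnitBall p) (hlim : ∀ x, Tendsto (fun i => f i x) l (𝓝 (g x))) {K : Set X}
    (hK : IsCompact K) {ε : ℝ} (hε : 0 < ε) : ∀ᶠ i in l, ∀ x ∈ K, |f i x - g x| < ε := by
  refine hK.induction_on (p := fun s => ∀ᶠ i in l, ∀ x ∈ s, |f i x - g x| < ε)
    (Eventually.of_forall fun i => by simp) ?_ ?_ ?_
  · exact fun s s' hs h => h.mono fun i hi x hx => hi x (hs hx)
  · intro s s' h h'
    filter_upwards [h, h'] with i hi hi'
    rintro x (hx | hx)
    exacts [hi x hx, hi' x hx]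
  · intro x _
    have h3 : 0 < ε / 3 := by positivity
    refine ⟨{y | p x y < ε / 3},
      mem_nhdsWithin_of_mem_nhds (eventually_lt_of_continuous hp x h3), ?_⟩
    filter_upwards [Metric.tendsto_nhds.1 (hlim x) _ h3] with i hi y hy
    rw [Real.dist_eq] at hi
    have hy' : p x y < ε / 3 := hy
    have e1 := abs_le.1 ((hf i).2 x y)
    have e2 := abs_le.1 (hg.2 x y)
    have e3 := abs_lt.1 hi
    exact abs_lt.2 ⟨by linarith, by linarith⟩

end Functions

/-! ### Uniform boundedness and dominated convergence. -/

section WeaklyCompact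

variable {X : Type*} [TopologicalSpace X] [MeasurableSpace X] [OpensMeasurableSpace X]

theorem tendsto_integralFunctional_of_weak {ι : Type*} {l : Filter ι} {u : ι → radonMeasures X}
    {μ : radonMeasures X} (h : Tendsto u l (@nhds _ (weakTopology X) μ)) (f : X →ᵇ ℝ) :
    Tendsto (fun i => integralFunctional f (u i)) l (𝓝 (integralFunctional f μ)) := by
  have := tendsto_seminormTopology_iff.1 h _ (mem_range_self f)
  rw [tendsto_iff_norm_sub_tendsto_zero]
  simpa only [Seminorm.comp_apply, coe_normSeminorm, map_sub] using this

/-- Each integral is weakly continuous, hence bounded on `S`; Banach–Steinhaus on bounded continuous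
functions makes the bound uniform. -/
theorem exists_bound_of_weaklyCompact {S : Set (radonMeasures X)}
    (hS : @IsCompact _ (weakTopology X) S) :
    ∃ M : ℝ, 0 ≤ M ∧ ∀ μ ∈ S, ∀ f : X →ᵇ ℝ, |integralFunctional f μ| ≤ M * ‖f‖ := by
  have h : ∀ f : X →ᵇ ℝ, ∃ C, ∀ μ : S, ‖integralCLM (μ : radonMeasures X) f‖ ≤ C := by
    intro f
    let := weakTopology X
    have hc : Continuous fun μ : radonMeasures X => integralFunctional f μ :=
      continuous_iff_continuousAt.2 fun μ => tendsto_integralFunctional_of_weak tendsto_id f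
    obtain ⟨C, hC⟩ := hS.exists_bound_of_continuousOn hc.continuousOn
    exact ⟨C, fun μ => hC μ μ.2⟩
  obtain ⟨C, hC⟩ := banach_steinhaus h
  refine ⟨|C|, abs_nonneg C, fun μ hμ f => ?_⟩
  exact (ContinuousLinearMap.le_opNorm (integralCLM μ) f).trans
    (mul_le_mul_of_nonneg_right ((hC ⟨μ, hμ⟩).trans (le_abs_self C)) (norm_nonneg f))

theorem tendsto_integralFunctional_of_dominated (μ : radonMeasures X) {f : ℕ → X →ᵇ ℝ}
    {g : X →ᵇ ℝ} {C : ℝ} (hf : ∀ n x, |f n x| ≤ C)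
    (hlim : ∀ x, Tendsto (fun n => f n x) atTop (𝓝 (g x))) :
    Tendsto (fun n => integralFunctional (f n) μ) atTop (𝓝 (integralFunctional g μ)) :=
  VectorMeasure.tendsto_integral_filter_of_norm_le_const
    (Eventually.of_forall fun n => (integrable_bcf (f n) μ).aestronglyMeasurable)
    ⟨C, Eventually.of_forall fun n => Eventually.of_forall (hf n)⟩ (Eventually.of_forall hlim)

end WeaklyCompact

/-! ### The sliding hump contradiction. -/

section SlidingHump

variable {X : Type*} [TopologicalSpace X] [MeasurableSpace X] [OpensMeasurableSpace X]
  {p : PseudoMetric X ℝ}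

/-- There is no sliding hump along a sequence in a weakly compact set: the sum `g` of the humps
would have `∫ g d(ν k - μ)` bounded away from zero, whereas it vanishes at a cluster point. -/
theorem false_of_slidingHump (hp : p ∈ continuousPseudometrics X) {S : Set (radonMeasures X)}
    (hS : @IsCompact _ (weakTopology X) S) (μ : radonMeasures X) {ν : ℕ → radonMeasures X}
    (hν : ∀ k, ν k ∈ S) {h : ℕ → X →ᵇ ℝ} {K : ℕ → Set X} {C η : ℝ} (hC : 0 ≤ C) (hη : 0 < η)
    (hK : ∀ k, MeasurableSet (K k)) (h1 : ∀ k x, |h k x| ≤ 1)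
    (hL : ∀ k x y, |h k x - h k y| ≤ C * p x y)
    (hnear : ∀ k x, h k x ≠ 0 → ∃ y ∈ K k, p x y < η / 2)
    (hfar : ∀ m k, m < k → ∀ x, h k x ≠ 0 → ∀ y ∈ K m, η < p x y)
    (hprev : ∀ m k, m < k → |integralFunctional (h m) (ν k - μ)| ≤ η * (1 / 2) ^ k)
    (htail : ∀ k, ((ν k - μ : radonMeasures X) : SignedMeasure X).variation.real (K k)ᶜ ≤ η)
    (hbig : ∀ k, 3 * η ≤ integralFunctional (h k) (ν k - μ)) : False := by
  obtain ⟨g, hg⟩ := exists_sum_of_separated hp hC (half_pos hη) h1 hL fun m n hmn x y hx hy => by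
    obtain ⟨z, hz, hxz⟩ := hnear m x hx
    have h2 := hfar m n hmn y hy z hz
    have h3 := p.triangle y x z
    rw [p.symm y x] at h3
    linarith
  have hsum : ∀ x n, g x = ∑ i ∈ Finset.range n, h i x ∨
      ∑ i ∈ Finset.range n, h i x = 0 := by
    intro x n
    obtain ⟨k, hk, hk'⟩ := hg x
    by_cases hkn : k < n
    · left
      rw [hk, Finset.sum_eq_single_of_mem k (Finset.mem_range.2 hkn) fun j _ hj => hk' j hj]
    · right
      refine Finset.sum_eq_zero fun i hi => hk' i ?_
      have := Finset.mem_range.1 hi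
      omega
  have hg1 : ∀ x, |g x| ≤ 1 := fun x => by
    obtain ⟨k, hk, -⟩ := hg x
    rw [hk]
    exact h1 k x
  let G : ℕ → X →ᵇ ℝ := fun n => ∑ i ∈ Finset.range n, h i
  have hG : ∀ n x, G n x = ∑ i ∈ Finset.range n, h i x := fun n x => by simp [G]
  have hlow : ∀ k, η ≤ integralFunctional g (ν k - μ) := by
    intro k
    -- Humps after the `k`-th vanish on `K k`, so their sum sees only the small mass outside `K k`.
    have hrest : |integralFunctional (g - G (k + 1)) (ν k - μ)| ≤ η := by
      refine (abs_integralFunctional_le _ (hK k).compl (fun x => ?_) fun x hx => ?_).trans (htail k)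
      · rw [BoundedContinuousFunction.sub_apply, hG]
        rcases hsum x (k + 1) with e | e
        · simp [e]
        · rw [e, sub_zero]
          exact hg1 x
      · have hxK : x ∈ K k := by simpa using hx
        rw [BoundedContinuousFunction.sub_apply, hG]
        rcases hsum x (k + 1) with e | e
        · simp [e]
        · obtain ⟨j, hj, hj'⟩ := hg x
          rw [e, sub_zero, hj]
          by_contra hne
          rcases lt_or_ge k j with hkj | hjk
          · have := hfar k j hkj x hne x hxK
            rw [p.refl] at this
            linarith
          · rw [Finset.sum_eq_single_of_mem j (Finset.mem_range.2 (by omega))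
              fun i _ hi => hj' i hi] at e
            exact hne e
    -- There are `k` earlier humps, each contributing at most `η * 2⁻ᵏ`, and `k ≤ 2ᵏ`. Of the `3 *
    -- η` from the `k`-th hump, at least `η` survives.
    have hpre : |∑ i ∈ Finset.range k, integralFunctional (h i) (ν k - μ)| ≤ η := by
      calc _ ≤ ∑ i ∈ Finset.range k, |integralFunctional (h i) (ν k - μ)| :=
            Finset.abs_sum_le_sum_abs _ _
        _ ≤ ∑ i ∈ Finset.range k, η * (1 / 2) ^ k :=
            Finset.sum_le_sum fun i hi => hprev i k (Finset.mem_range.1 hi)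
        _ = η * (k * (1 / 2) ^ k) := by
            rw [Finset.sum_const, Finset.card_range, nsmul_eq_mul]
            ring
        _ ≤ η * 1 := by
            refine mul_le_mul_of_nonneg_left ?_ hη.le
            rw [one_div, inv_pow, ← div_eq_mul_inv, div_le_one (by positivity)]
            exact_mod_cast Nat.lt_two_pow_self.le
        _ = η := mul_one η
    rw [integralFunctional_sub, integralFunctional_sum, Finset.sum_range_succ] at hrest
    have h3 := (abs_le.1 hrest).1
    have h4 := (abs_le.1 hpre).1
    linarith [hbig k]
  obtain ⟨ν', -, hν'⟩ := (@isCompact_iff_ultrafilter_le_nhds' _ (weakTopology X) S).1 hS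
    ((hyperfilter ℕ).map ν) (Ultrafilter.mem_map.2 (univ_mem' hν))
  have hlim : ∀ f : X →ᵇ ℝ, Tendsto (fun k => integralFunctional f (ν k - μ)) (hyperfilter ℕ)
      (𝓝 (integralFunctional f (ν' - μ))) := fun f => by
    rw [map_sub (integralFunctional f)]
    exact ((tendsto_integralFunctional_of_weak (u := ν) hν' f).sub_const _).congr fun k =>
      (map_sub (integralFunctional f) _ _).symm
  have hat : (hyperfilter ℕ : Filter ℕ) ≤ atTop := Nat.hyperfilter_le_atTop
  have hzero : ∀ m, integralFunctional (h m) (ν' - μ) = 0 := by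
    intro m
    refine tendsto_nhds_unique (hlim (h m)) (squeeze_zero_norm' (a := fun k => η * (1 / 2) ^ k) ?_ ?_)
    · filter_upwards [hat (eventually_gt_atTop m)] with k hk
      exact hprev m k hk
    · have := (tendsto_pow_atTop_nhds_zero_of_lt_one (r := (1 / 2 : ℝ)) (by norm_num)
        (by norm_num)).const_mul η
      rw [mul_zero] at this
      exact this.mono_left hat
  have hgzero : integralFunctional g (ν' - μ) = 0 := by
    refine tendsto_nhds_unique (tendsto_integralFunctional_of_dominated (ν' - μ) (f := G) (C := 1)
      (fun n x => ?_) fun x => ?_) ?_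
    · rw [hG]
      rcases hsum x n with e | e
      · rw [← e]
        exact hg1 x
      · simp [e]
    · obtain ⟨k, hk, hk'⟩ := hg x
      refine tendsto_const_nhds.congr' ?_
      filter_upwards [eventually_gt_atTop k] with n hn
      rw [hG, hk, Finset.sum_eq_single_of_mem k (Finset.mem_range.2 hn) fun j _ hj => hk' j hj]
    · refine tendsto_const_nhds.congr fun n => ?_
      rw [integralFunctional_sum]
      exact (Finset.sum_eq_zero fun i _ => hzero i).symm
  have := ge_of_tendsto (hlim g) (Eventually.of_forall hlow)
  linarith

end SlidingHump

/-! ### Construction of the humps and conclusion. -/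

section Continuity

theorem half_sub_mem_lipUnitBall {X : Type*} [TopologicalSpace X] {p : PseudoMetric X ℝ}
    {f g : X →ᵇ ℝ} (hf : f ∈ lipUnitBall p) (hg : g ∈ lipUnitBall p) :
    (1 / 2 : ℝ) • (f - g) ∈ lipUnitBall p := by
  refine ⟨fun x => ?_, fun x y => ?_⟩ <;>
    simp only [BoundedContinuousFunction.coe_smul, BoundedContinuousFunction.sub_apply, smul_eq_mul]
  · have h1 := abs_le.1 (hf.1 x)
    have h2 := abs_le.1 (hg.1 x)
    exact abs_le.2 ⟨by linarith, by linarith⟩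
  · have h1 := abs_le.1 (hf.2 x y)
    have h2 := abs_le.1 (hg.2 x y)
    exact abs_le.2 ⟨by linarith, by linarith⟩

/-- A hump: a test function concentrated near a set that carries most of a measure. -/
structure Hump (X : Type*) [TopologicalSpace X] [MeasurableSpace X] where
  /-- The measure on which the test function is large. -/
  measure : radonMeasures X
  /-- The test function. -/
  testFun : X →ᵇ ℝ
  /-- The set near which the test function is concentrated. -/
  carrier : Set X
  /-- The position in the sequence of humps. -/
  index : ℕ

variable {X : Type*} [TopologicalSpace X] [T2Space X] [MeasurableSpace X] [BorelSpace X]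
  {p : PseudoMetric X ℝ}

/-- Two losses separate `u` from its hump: `M * (2 * η)` for the thresholding, and `η` for the
cutoff, which changes nothing on the compact set `K`. -/
theorem exists_hump (hp : p ∈ continuousPseudometrics X) {η a M : ℝ} (hη : 0 < η)
    (σ : radonMeasures X) (hM : ∀ f : X →ᵇ ℝ, |integralFunctional f σ| ≤ M * ‖f‖) (hM0 : 0 ≤ M)
    {u : X →ᵇ ℝ} (hu : u ∈ lipUnitBall p) (ha : a + η + M * (2 * η) ≤ integralFunctional u σ) :
    ∃ (h : X →ᵇ ℝ) (K : Set X), IsCompact K ∧ (σ : SignedMeasure X).variation.real Kᶜ ≤ η ∧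
      (∀ x, |h x| ≤ 1) ∧ (∀ x y, |h x - h y| ≤ (1 + (η / 2)⁻¹) * p x y) ∧
      (∀ x, h x ≠ 0 → ∃ y ∈ K, p x y < η / 2) ∧ (∀ x, h x ≠ 0 → 2 * η < |u x|) ∧
      a ≤ integralFunctional h σ := by
  obtain ⟨K, hK, -, hKη⟩ := exists_compact_variation_lt σ MeasurableSet.univ hη
  rw [← compl_eq_univ_sdiff] at hKη
  obtain ⟨h, v, h1, hL, hnear, hbig, hvu, hhv, hKv⟩ := exists_localization hp hη K hu
  refine ⟨h, K, hK, hKη.le, h1, hL, hnear, hbig, ?_⟩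
  have e1 : |integralFunctional (h - v) σ| ≤ η :=
    (abs_integralFunctional_le σ hK.measurableSet.compl hhv fun x hx => by
      rw [BoundedContinuousFunction.sub_apply, hKv x (by simpa using hx), sub_self]).trans hKη.le
  have e2 : |integralFunctional (v - u) σ| ≤ M * (2 * η) :=
    (hM _).trans (mul_le_mul_of_nonneg_left
      ((BoundedContinuousFunction.norm_le (by positivity)).2 hvu) hM0)
  rw [integralFunctional_sub] at e1 e2
  linarith [(abs_le.1 e1).1, (abs_le.1 e2).1]

/-- On a weakly compact set, weak convergence implies convergence in each of the
Kantorovich–Rubinstein seminorms. -/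
theorem tendsto_krNorm_of_weaklyCompact (hp : p ∈ continuousPseudometrics X)
    {S : Set (radonMeasures X)} (hS : @IsCompact _ (weakTopology X) S) {μ : radonMeasures X}
    (hμ : μ ∈ S) {F : Ultrafilter (radonMeasures X)} (hFS : S ∈ F)
    (hF : ↑F ≤ @nhds _ (weakTopology X) μ) :
    Tendsto (fun ν => krNorm p (ν - μ)) F (𝓝 0) := by
  have hnonneg : ∀ ν, 0 ≤ krNorm p (ν - μ) := fun ν =>
    (abs_nonneg _).trans (le_krNorm (zero_mem_lipUnitBall p) _)
  by_contra hcon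
  -- An ultrafilter decides every inequality, so failure of convergence gives a lower bound
  -- eventually, not merely frequently.
  obtain ⟨ε, hε, hev⟩ : ∃ ε > 0, ∀ᶠ ν in F, ε ≤ krNorm p (ν - μ) := by
    by_contra! hno
    refine hcon (Metric.tendsto_nhds.2 fun ε hε => ?_)
    refine (hno ε hε).mono fun ν hν => ?_
    rw [Real.dist_eq, sub_zero, abs_of_nonneg (hnonneg ν)]
    exact hν
  -- The bound on the norm is kept as a premise so that a test function in the unit ball is chosen
  -- for every `ν`.
  have hex : ∀ ν, ∃ f ∈ lipUnitBall p, ε ≤ krNorm p (ν - μ) →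
      ε / 2 < integralFunctional f (ν - μ) := by
    intro ν
    by_contra! hno
    have h0 := (hno 0 (zero_mem_lipUnitBall p)).1
    have := krNorm_le fun f hf => (hno f hf).2
    linarith
  choose f hf hfbig using hex
  obtain ⟨g, hg, hlim⟩ := exists_tendsto_of_lipUnitBall hp F hf
  have hweak : ∀ h : X →ᵇ ℝ, Tendsto (fun ν => integralFunctional h (ν - μ)) F (𝓝 0) := fun h => by
    have := (tendsto_integralFunctional_of_weak (u := id) (tendsto_id'.2 hF) h).sub_const
      (integralFunctional h μ)
    rw [sub_self] at this
    exact this.congr fun ν => (map_sub (integralFunctional h) _ _).symm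
  obtain ⟨M, hM0, hM⟩ := exists_bound_of_weaklyCompact hS
  have hMsub : ∀ ν ∈ S, ∀ h : X →ᵇ ℝ, |integralFunctional h (ν - μ)| ≤ 2 * M * ‖h‖ := by
    intro ν hν h
    rw [map_sub (integralFunctional h)]
    linarith [abs_sub (integralFunctional h ν) (integralFunctional h μ), hM ν hν h, hM μ hμ h]
  -- Chosen so that a hump of size `3 * η` remains after both losses in `exists_hump`, with bound `2
  -- * M` for `ν - μ` and starting value `ε / 8 = (ε / 2 - ε / 4) / 2`.
  let η : ℝ := ε / (8 * (4 + 4 * M))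
  have hη : 0 < η := by positivity
  have hηε : 3 * η + η + 2 * M * (2 * η) = ε / 8 := by
    simp only [η]
    field_simp
    ring
  let u : radonMeasures X → X →ᵇ ℝ := fun ν => (1 / 2 : ℝ) • (f ν - g)
  have hu : ∀ ν, u ν ∈ lipUnitBall p := fun ν => half_sub_mem_lipUnitBall (hf ν) hg
  have hubig : ∀ᶠ ν in F, ε / 8 ≤ integralFunctional (u ν) (ν - μ) := by
    filter_upwards [hev, (hweak g).eventually_lt_const (show 0 < ε / 4 by positivity)]
      with ν hν hgν
    simp only [u]
    rw [integralFunctional_smul, integralFunctional_sub]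
    linarith [hfbig ν hν]
  obtain ⟨H, hH, hrel⟩ := exists_seq_of_forall_finset_exists
    (fun y : Hump X => y.measure ∈ S ∧ IsCompact y.carrier ∧
      ((y.measure - μ : radonMeasures X) : SignedMeasure X).variation.real y.carrierᶜ ≤ η ∧
      (∀ x, |y.testFun x| ≤ 1) ∧
      (∀ x z, |y.testFun x - y.testFun z| ≤ (1 + (η / 2)⁻¹) * p x z) ∧
      (∀ x, y.testFun x ≠ 0 → ∃ z ∈ y.carrier, p x z < η / 2) ∧
      3 * η ≤ integralFunctional y.testFun (y.measure - μ))
    (fun y z : Hump X => y.index < z.index ∧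
      (∀ x, z.testFun x ≠ 0 → ∀ w ∈ y.carrier, η < p x w) ∧
      |integralFunctional y.testFun (z.measure - μ)| ≤ η * (1 / 2) ^ z.index)
    (fun s hs => by
      -- Exceeding all earlier indices makes `index` strictly increasing along the sequence, so the
      -- `k`-th one is at least `k` and decay in `index` gives decay in `k`.
      let n := s.sup Hump.index + 1
      have hpos : 0 < η * (1 / 2) ^ n := by positivity
      have hsmall : ∀ᶠ ν in F, ∀ y ∈ s, (∀ w ∈ y.carrier, |f ν w - g w| < 2 * η) ∧
          |integralFunctional y.testFun (ν - μ)| < η * (1 / 2) ^ n := by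
        rw [Filter.eventually_all_finset]
        intro y hy
        have h0 := (hweak y.testFun).abs
        rw [abs_zero] at h0
        exact (eventually_forall_compact_of_lipUnitBall hp hf hg hlim (hs y hy).2.1
          (by positivity)).and (h0.eventually_lt_const hpos)
      obtain ⟨ν, hνS, hνu, hνs⟩ := ((show ∀ᶠ ν in F, ν ∈ S from hFS).and
        (hubig.and hsmall)).exists
      obtain ⟨h, K, hK, htail, h1, hL, hnear, hsupp, hbig⟩ := exists_hump hp hη (a := 3 * η)
        (ν - μ) (hMsub ν hνS) (by positivity) (hu ν) (hηε.trans_le hνu)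
      refine ⟨⟨ν, h, K, n⟩, ⟨hνS, hK, htail, h1, hL, hnear, hbig⟩, fun y hy => ⟨?_, ?_, ?_⟩⟩
      · exact Nat.lt_succ_of_le (Finset.le_sup (f := Hump.index) hy)
      · intro x hx w hw
        -- On earlier carriers `|u ν| < η`, on the support of the new hump `|u ν| > 2 * η`; the
        -- Lipschitz bound then forces distance greater than `η`.
        have e1 : |u ν w| < η := by
          simp only [u, BoundedContinuousFunction.coe_smul, BoundedContinuousFunction.sub_apply,
            smul_eq_mul]
          rw [abs_mul, abs_of_pos (by norm_num : (0 : ℝ) < 1 / 2)]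
          linarith [(hνs y hy).1 w hw]
        have e2 := hsupp x hx
        have e3 := (hu ν).2 x w
        linarith [abs_sub_abs_le_abs_sub (u ν x) (u ν w)]
      · exact (hνs y hy).2.le)
  have hindex : ∀ k, k ≤ (H k).index := fun k =>
    (strictMono_nat_of_lt_succ fun n => (hrel n (n + 1) n.lt_succ_self).1).le_apply
  refine false_of_slidingHump hp hS μ (ν := fun k => (H k).measure) (h := fun k => (H k).testFun)
    (K := fun k => (H k).carrier) (C := 1 + (η / 2)⁻¹) (η := η) (fun k => (hH k).1)
    (by positivity) hη (fun k => (hH k).2.1.measurableSet) (fun k => (hH k).2.2.2.1)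
    (fun k => (hH k).2.2.2.2.1) (fun k => (hH k).2.2.2.2.2.1)
    (fun m k hmk => (hrel m k hmk).2.1) (fun m k hmk => (hrel m k hmk).2.2.trans ?_)
    (fun k => (hH k).2.2.1) (fun k => (hH k).2.2.2.2.2.2)
  exact mul_le_mul_of_nonneg_left
    (pow_le_pow_of_le_one (by norm_num) (by norm_num) (hindex k)) hη.le

theorem coincideOn_weakTopology_krTopology {S : Set (radonMeasures X)}
    (hS : @IsCompact _ (weakTopology X) S) {P : Set (PseudoMetric X ℝ)} (hP : GeneratesTopology P)
    (hd : IsDirectedFamily P) : CoincideOn (weakTopology X) (krTopology P) S := by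
  refine coincideOn_of_isCompact hS (t2Space_krTopology hP hd) fun μ hμ F hFS hF => ?_
  refine (tendsto_seminormTopology_iff (u := id) (l := (F : Filter (radonMeasures X)))).2 ?_
  rintro _ ⟨p, hp, rfl⟩
  exact tendsto_krNorm_of_weaklyCompact (hP.subset_continuousPseudometrics hp) hS hμ hFS hF

end Continuity

end

end KantorovichRubinstein

/-- The argument is a sliding hump along ultrafilters and does not use the countability hypothesis
`hX`: Radon measures are concentrated on compact sets up to small errors, which is enough. -/
theorem proposition2p3 {X : Type*} [TopologicalSpace X] [T35Space X] [MeasurableSpace X]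
    [BorelSpace X]
    (hX : TopologicalSpace.SeparableSpace X ∨
      ∃ F : Set C(X, ℝ), F.Countable ∧ ∀ x y : X, x ≠ y → ∃ f ∈ F, f x ≠ f y)
    (S : Set (KantorovichRubinstein.radonMeasures X))
    (hS : @IsCompact _ (KantorovichRubinstein.weakTopology X) S) :
    KantorovichRubinstein.CoincideOn (KantorovichRubinstein.weakTopology X)
      (KantorovichRubinstein.krTopology (KantorovichRubinstein.continuousPseudometrics X)) S ∧
    ∀ P : Set (PseudoMetric X ℝ), KantorovichRubinstein.GeneratesTopology P →
      KantorovichRubinstein.IsDirectedFamily P →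
      KantorovichRubinstein.CoincideOn (KantorovichRubinstein.weakTopology X)
        (KantorovichRubinstein.krTopology P) S := by
  exact ⟨KantorovichRubinstein.coincideOn_weakTopology_krTopology hS
      (KantorovichRubinstein.generatesTopology_continuousPseudometrics X)
      (KantorovichRubinstein.isDirectedFamily_continuousPseudometrics X),
    fun P hP hd => KantorovichRubinstein.coincideOn_weakTopology_krTopology hS hP hd⟩
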